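/- Let $t \ge 1$ be an integer and let $0 \le d < k \le \infty$, with $d$ an integer and $k$ an integer or $\infty$. Let $\mathcal{S}_{d,k}(n)$ be the set of binary strings of length $n$ that are concatenations of blocks $0^j 1$ with $j$ a (finite) integer, $d \le j \le k$. For a binary string $x$ of weight $W$ (number of $1$'s), let $\bar{x} \in \mathbb{Z}^W$ be the vector whose $i$-th coordinate is the position of the $i$-th $1$ in $x$. A code $\mathcal{C} \subseteq \mathcal{S}_{d,k}(n)$ corrects $t$ (symmetric) shifts if for all $x, y \in \mathcal{C}$ with $x \ne y$ and of the same weight $W$, and all $f, g \in \mathbb{Z}^W$ with $\sum_{i=1}^W |f_i| \le t$ and $\sum_{i=1}^W |g_i| \le t$, one has $\bar{x} + f \ne \bar{y} + g$. Let $M^{\mathrm{s}}_{d,k}(n;t)$ be the largest cardinality of a code $\mathcal{C} \subseteq \mathcal{S}_{d,k}(n)$ that corrects $t$ shifts. Then the equation $\sum_{i=d+1}^{k+1} x^i = 1$ has a unique positive solution $\rho$, and, for fixed $t, d, k$, as $n \to \infty$, $$ \log M^{\mathrm{s}}_{d,k}(n;t) = -n \log \rho - t \log n + \mathcal{O}(1),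 $$ where $\log$ is the base-$2$ logarithm. -/

import Mathlib

open Filter Asymptotics

namespace BitShift

/-- The set of blocks `0^j 1` with `d ≤ j ≤ k` (`j` finite, `k = ⊤` allowed), as a language over
the binary alphabet (`false` is the symbol 0 and `true` is the symbol 1). -/
def blocks (d : ℕ) (k : ℕ∞) : Language Bool :=
  {w | ∃ j : ℕ, d ≤ j ∧ (j : ℕ∞) ≤ k ∧ w = List.replicate j false ++ [true]}

/-- The `(d,k)`-constrained channel inputs of length `n`: the binary strings of length `n` that are
concatenations of blocks `0^j 1`, `d ≤ j ≤ k`. -/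
def inputs (d : ℕ) (k : ℕ∞) (n : ℕ) : Set (Fin n → Bool) :=
  {x | List.ofFn x ∈ KStar.kstar (blocks d k)}

/-- The set of (zero-based) indices at which a binary string has the symbol 1. -/
def ones {n : ℕ} (x : Fin n → Bool) : Finset (Fin n) :=
  Finset.univ.filter fun i => x i = true

/-- The Hamming weight. -/
def weight {n : ℕ} (x : Fin n → Bool) : ℕ :=
  (ones x).card

/-- The vector of positions of the 1's of a string of weight `W`, in increasing order;
positions in a string of length `n` are numbered `1, …, n`. -/
def positions {n W : ℕ} (x : Fin n → Bool) (h : weight x = W) : Fin W → ℤ :=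
  fun i => (((ones x).orderEmbOfFin h i : Fin n) : ℕ) + 1

/-- The code `C` corrects `t` shifts: no two different codewords (of the same weight, as the channel
preserves the weight) can produce the same output after patterns of at most `t` shifts each. -/
def CorrectsShifts {n : ℕ} (t : ℕ) (C : Finset (Fin n → Bool)) : Prop :=
  ∀ x ∈ C, ∀ y ∈ C, x ≠ y → ∀ (W : ℕ) (hx : weight x = W) (hy : weight y = W) (f g : Fin W → ℤ),
    ∑ i, |f i| ≤ (t : ℤ) → ∑ i, |g i| ≤ (t : ℤ) → positions x hx + f ≠ positions y hy + g

open Classical in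
/-- The cardinality of an optimal code, i.e. the largest cardinality of a set of
`(d,k)`-constrained strings of length `n` that corrects `t` shifts. -/
noncomputable def maxCodeSize (d : ℕ) (k : ℕ∞) (n t : ℕ) : ℕ :=
  ((Finset.univ : Finset (Finset (Fin n → Bool))).filter fun C =>
    (∀ x ∈ C, x ∈ inputs d k n) ∧ CorrectsShifts t C).sup Finset.card

/-- `x` is a positive solution of `∑_{i=d+1}^{k+1} x^i = 1` (a convergent series if `k = ⊤`). -/
def IsPositiveRoot (d : ℕ) (k : ℕ∞) (x : ℝ) : Prop :=
  0 < x ∧ HasSum (fun i : {i : ℕ // d + 1 ≤ i ∧ (i : ℕ∞) ≤ k + 1} => x ^ (i : ℕ)) 1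

end BitShift

namespace BitShift

/-- The lengths of the blocks `0^j 1`, `d ≤ j ≤ k`. -/
def blockLengths (d : ℕ) (k : ℕ∞) : Set ℕ :=
  {i | d + 1 ≤ i ∧ (i : ℕ∞) ≤ k + 1}

/-- The generating function `∑_{i=d+1}^{k+1} x^i` of the block lengths. -/
noncomputable def lengthSeries (d : ℕ) (k : ℕ∞) (x : ℝ) : ℝ :=
  ∑' i : blockLengths d k, x ^ (i : ℕ)

variable {d : ℕ} {k : ℕ∞} {x y ρ : ℝ}

theorem isPositiveRoot_iff :
    IsPositiveRoot d k x ↔ 0 < x ∧ HasSum (fun i : blockLengths d k => x ^ (i : ℕ)) 1 :=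
  Iff.rfl

theorem pos_of_mem_blockLengths {a : ℕ} (ha : a ∈ blockLengths d k) : 0 < a :=
  lt_of_lt_of_le (Nat.succ_pos d) ha.1

theorem add_one_mem_blockLengths (h : (d : ℕ∞) < k) : d + 1 ∈ blockLengths d k := by
  refine ⟨le_rfl, ?_⟩
  push_cast
  gcongr

theorem add_two_mem_blockLengths (h : (d : ℕ∞) < k) : d + 2 ∈ blockLengths d k := by
  refine ⟨by omega, ?_⟩
  have h1 : ((d + 1 : ℕ) : ℕ∞) ≤ k := by
    push_cast
    exact Order.add_one_le_of_lt h
  calc ((d + 2 : ℕ) : ℕ∞) = ((d + 1 : ℕ) : ℕ∞) + 1 := by push_cast; ring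
    _ ≤ k + 1 := by gcongr

theorem summable_lengthSeries (hx0 : 0 ≤ x) (hx1 : x < 1) :
    Summable (fun i : blockLengths d k => x ^ (i : ℕ)) :=
  (summable_geometric_of_lt_one hx0 hx1).subtype _

theorem pow_add_pow_le_of_hasSum (hdk : (d : ℕ∞) < k) (hx0 : 0 ≤ x) {s : ℝ}
    (h : HasSum (fun i : blockLengths d k => x ^ (i : ℕ)) s) : x ^ (d + 1) + x ^ (d + 2) ≤ s := by
  classical
  have := sum_le_hasSum {⟨d + 1, add_one_mem_blockLengths hdk⟩, ⟨d + 2, add_two_mem_blockLengths hdk⟩}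
    (fun i _ => pow_nonneg hx0 _) h
  rwa [Finset.sum_pair (by simp)] at this

theorem IsPositiveRoot.lt_one (hdk : (d : ℕ∞) < k) (h : IsPositiveRoot d k ρ) : ρ < 1 := by
  by_contra! hρ
  have h1 := pow_add_pow_le_of_hasSum hdk h.1.le h.2
  have h2 : 1 ≤ ρ ^ (d + 1) := one_le_pow₀ hρ
  have h3 : 1 ≤ ρ ^ (d + 2) := one_le_pow₀ hρ
  linarith

theorem not_lt_of_isPositiveRoot (hdk : (d : ℕ∞) < k) (hx : IsPositiveRoot d k x)
    (hy : IsPositiveRoot d k y) : ¬ x < y := fun hxy => by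
  have : (1 : ℝ) < 1 := hasSum_lt (i := ⟨d + 1, add_one_mem_blockLengths hdk⟩)
    (fun i => pow_le_pow_left₀ hx.1.le hxy.le _)
    (pow_lt_pow_left₀ hxy hx.1.le (by simp)) hx.2 hy.2
  exact lt_irrefl _ this

theorem continuousOn_lengthSeries {R : ℝ} (hR0 : 0 ≤ R) (hR : R < 1) :
    ContinuousOn (lengthSeries d k) (Set.Icc 0 R) := by
  refine continuousOn_tsum (u := fun i : blockLengths d k => R ^ (i : ℕ))
    (fun i => (continuous_pow _).continuousOn) (summable_lengthSeries hR0 hR) ?_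
  intro i x hx
  rw [Real.norm_of_nonneg (pow_nonneg hx.1 _)]
  exact pow_le_pow_left₀ hx.1 hx.2 _

theorem lengthSeries_zero : lengthSeries d k 0 = 0 := by
  unfold lengthSeries
  convert tsum_zero with i
  exact zero_pow (pos_of_mem_blockLengths i.2).ne'

theorem existsUnique_isPositiveRoot (hdk : (d : ℕ∞) < k) : ∃! ρ : ℝ, IsPositiveRoot d k ρ := by
  have key : ∃ R : ℝ, 0 ≤ R ∧ R < 1 ∧ 1 ≤ lengthSeries d k R := by
    set e : ℝ := 1 / (2 * ((d + 2 : ℕ) : ℝ)) with he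
    have hd : (2 : ℝ) ≤ ((d + 2 : ℕ) : ℝ) := by push_cast; linarith [(Nat.cast_nonneg d : (0 : ℝ) ≤ d)]
    have he0 : 0 < e := by positivity
    have he1 : ((d + 2 : ℕ) : ℝ) * e = 1 / 2 := by rw [he]; field_simp
    have he2 : e ≤ 1 := by nlinarith
    have hb : 1 / 2 ≤ (1 - e) ^ (d + 2) := by
      have := one_add_mul_le_pow (a := -e) (by linarith) (d + 2)
      rw [← sub_eq_add_neg] at this
      linarith
    have hb' : (1 - e) ^ (d + 2) ≤ (1 - e) ^ (d + 1) :=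
      pow_le_pow_of_le_one (by linarith) (by linarith) (by omega)
    refine ⟨1 - e, by linarith, by linarith, ?_⟩
    have := pow_add_pow_le_of_hasSum hdk (x := 1 - e) (by linarith)
      (summable_lengthSeries (by linarith) (by linarith)).hasSum
    unfold lengthSeries
    linarith
  obtain ⟨R, hR0, hR1, hR⟩ := key
  obtain ⟨ρ, hρ, hρ1⟩ := intermediate_value_Icc hR0 (continuousOn_lengthSeries (d := d) (k := k) hR0 hR1)
    (show (1 : ℝ) ∈ Set.Icc _ _ from ⟨by rw [lengthSeries_zero]; exact zero_le_one, hR⟩)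
  have hne : ρ ≠ 0 := by
    rintro rfl
    rw [lengthSeries_zero] at hρ1
    exact zero_ne_one hρ1
  have hroot : IsPositiveRoot d k ρ := by
    refine isPositiveRoot_iff.2 ⟨lt_of_le_of_ne hρ.1 hne.symm, ?_⟩
    rw [← hρ1]
    exact (summable_lengthSeries hρ.1 (hρ.2.trans_lt hR1)).hasSum
  exact ⟨ρ, hroot, fun y hy => le_antisymm (not_lt.1 (not_lt_of_isPositiveRoot hdk hroot hy))
    (not_lt.1 (not_lt_of_isPositiveRoot hdk hy hroot))⟩

theorem IsPositiveRoot.exists_gt (hdk : (d : ℕ∞) < k) (h : IsPositiveRoot d k ρ) :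
    ∃ r, ρ < r ∧ r < 1 ∧ lengthSeries d k r ^ 2 - r ^ (2 * d + 3) / 2 < 1 := by
  have hρ1 := h.lt_one hdk
  obtain ⟨R, hρR, hR1⟩ := exists_between hρ1
  have hcont : ContinuousWithinAt (fun r => lengthSeries d k r ^ 2 - r ^ (2 * d + 3) / 2)
      (Set.Icc 0 R) ρ :=
    (((continuousOn_lengthSeries (h.1.le.trans hρR.le) hR1) ρ ⟨h.1.le, hρR.le⟩).pow 2).sub
      ((continuous_pow _).div_const 2).continuousWithinAt
  have hval : lengthSeries d k ρ ^ 2 - ρ ^ (2 * d + 3) / 2 < 1 := by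
    have : lengthSeries d k ρ = 1 := h.2.tsum_eq
    rw [this]
    have := pow_pos h.1 (2 * d + 3)
    linarith
  have hev := hcont.eventually (gt_mem_nhds hval)
  have hle : nhdsWithin ρ (Set.Ioo ρ R) ≤ nhdsWithin ρ (Set.Icc 0 R) :=
    nhdsWithin_mono _ fun y hy => ⟨h.1.le.trans hy.1.le, hy.2.le⟩
  have : (nhdsWithin ρ (Set.Ioo ρ R)).NeBot := left_nhdsWithin_Ioo_neBot hρR
  obtain ⟨r, hr, hr'⟩ := (Filter.Eventually.and (hev.filter_mono hle) self_mem_nhdsWithin).exists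
  exact ⟨r, hr'.1, hr'.2.trans hR1, hr⟩

end BitShift

namespace BitShift

/-- The concatenation of the blocks `0^(a-1) 1`, where `a` runs through the list `l`. -/
def blockWord (l : List ℕ) : List Bool :=
  l.flatMap fun a => List.replicate (a - 1) false ++ [true]

@[simp]
theorem blockWord_nil : blockWord [] = [] := rfl

theorem blockWord_cons (a : ℕ) (l : List ℕ) :
    blockWord (a :: l) = List.replicate (a - 1) false ++ [true] ++ blockWord l := by
  simp [blockWord]

theorem length_blockWord {l : List ℕ} (hl : ∀ a ∈ l, 0 < a) : (blockWord l).length = l.sum := by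
  induction l with
  | nil => rfl
  | cons a l ih =>
    have ha := hl a (by simp)
    simp only [blockWord_cons, List.length_append, List.length_replicate, List.length_singleton,
      List.sum_cons, ih fun b hb => hl b (List.mem_cons_of_mem _ hb)]
    omega

theorem getElem?_blockWord_cons {a : ℕ} (ha : 0 < a) (l : List ℕ) (j : ℕ) :
    (blockWord (a :: l))[j]? =
      if j + 1 < a then some false else if j + 1 = a then some true else (blockWord l)[j - a]? := by
  rw [blockWord_cons]
  split_ifs with h1 h2
  · rw [List.getElem?_append_left (by simp; omega), List.getElem?_append_left (by simp; omega)]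
    exact List.getElem?_replicate_of_lt (by omega)
  · rw [List.getElem?_append_left (by simp; omega), List.getElem?_append_right (by simp; omega)]
    rw [List.length_replicate, show j - (a - 1) = 0 by omega]
    rfl
  · rw [List.getElem?_append_right (by simp; omega)]
    congr 1
    simp; omega

theorem blockWord_injective {l l' : List ℕ} (hl : ∀ a ∈ l, 0 < a) (hl' : ∀ a ∈ l', 0 < a)
    (h : blockWord l = blockWord l') : l = l' := by
  induction l generalizing l' with
  | nil =>
    cases l' with
    | nil => rfl
    | cons b l' => simp [blockWord_cons] at h
  | cons a l ih =>
    cases l' with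
    | nil => simp [blockWord_cons] at h
    | cons b l' =>
      have ha := hl a (by simp)
      have hb := hl' b (by simp)
      have hab : a = b := by
        have h1 := congrArg (fun w => w[a - 1]?) h
        have h2 := congrArg (fun w => w[b - 1]?) h
        simp only [getElem?_blockWord_cons ha, getElem?_blockWord_cons hb] at h1 h2
        rcases lt_trichotomy a b with hab | hab | hab
        · rw [if_neg (by omega), if_pos (by omega), if_pos (by omega)] at h1
          simp at h1
        · exact hab
        · rw [if_pos (by omega), if_neg (by omega), if_pos (by omega)] at h2
          simp at h2
      subst hab
      rw [blockWord_cons, blockWord_cons, List.append_cancel_left_eq] at h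
      rw [ih (fun c hc => hl c (List.mem_cons_of_mem _ hc))
        (fun c hc => hl' c (List.mem_cons_of_mem _ hc)) h]

theorem mem_kstar_blocks_iff {d : ℕ} {k : ℕ∞} {w : List Bool} :
    w ∈ KStar.kstar (blocks d k) ↔ ∃ l : List ℕ, (∀ a ∈ l, a ∈ blockLengths d k) ∧ w = blockWord l := by
  rw [Language.mem_kstar]
  constructor
  · rintro ⟨L, rfl, hL⟩
    induction L with
    | nil => exact ⟨[], by simp, rfl⟩
    | cons u L ih =>
      obtain ⟨l, hl, hw⟩ := ih fun y hy => hL y (List.mem_cons_of_mem _ hy)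
      obtain ⟨j, hj1, hj2, hu⟩ := hL u (by simp)
      refine ⟨(j + 1) :: l, ?_, ?_⟩
      · intro a ha
        rcases List.mem_cons.1 ha with rfl | ha
        · refine ⟨by omega, ?_⟩
          push_cast
          gcongr
        · exact hl a ha
      · rw [blockWord_cons, List.flatten_cons, hw, hu]
        simp
  · rintro ⟨l, hl, rfl⟩
    refine ⟨l.map fun a => List.replicate (a - 1) false ++ [true], by
      rw [blockWord, List.flatMap_def], ?_⟩
    intro y hy
    obtain ⟨a, ha, rfl⟩ := List.mem_map.1 hy
    obtain ⟨h1, h2⟩ := hl a ha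
    refine ⟨a - 1, by omega, ?_, rfl⟩
    have h3 : ((a - 1 : ℕ) : ℕ∞) + 1 ≤ k + 1 := by
      have : ((a - 1 : ℕ) : ℕ∞) + 1 = (a : ℕ∞) := by
        exact_mod_cast Nat.sub_add_cancel (by omega)
      rwa [this]
    exact (ENat.add_le_add_iff_right (by simp)).1 h3

theorem getElem?_blockWord_eq_true_iff {l : List ℕ} (hl : ∀ a ∈ l, 0 < a) (j : ℕ) :
    (blockWord l)[j]? = some true ↔ ∃ i < l.length, j + 1 = (l.take (i + 1)).sum := by
  induction l generalizing j with
  | nil => simp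
  | cons a l ih =>
    have ha := hl a (by simp)
    have ih := ih fun b hb => hl b (List.mem_cons_of_mem _ hb)
    rw [getElem?_blockWord_cons ha]
    simp only [List.length_cons, List.take_succ_cons, List.sum_cons]
    split_ifs with h1 h2
    · constructor
      · intro h; simp at h
      · rintro ⟨i, -, hi⟩; omega
    · exact ⟨fun _ => ⟨0, by omega, by simpa using h2⟩, fun _ => rfl⟩
    · rw [ih]
      constructor
      · rintro ⟨i, hi, hj⟩
        exact ⟨i + 1, by omega, by omega⟩
      · rintro ⟨i, hi, hj⟩
        cases i with
        | zero => simp at hj; omega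
        | succ i => exact ⟨i, by omega, by omega⟩

theorem sum_take_lt_sum_take {l : List ℕ} (hl : ∀ a ∈ l, 0 < a) {i j : ℕ} (hij : i < j)
    (hj : j ≤ l.length) : (l.take i).sum < (l.take j).sum := by
  induction j, hij using Nat.le_induction with
  | base =>
    rw [List.sum_take_succ _ _ (by omega)]
    exact Nat.lt_add_of_pos_right (hl _ (List.getElem_mem _))
  | succ j hij ih =>
    rw [List.sum_take_succ _ _ (by omega)]
    exact (ih (by omega)).trans_le (Nat.le_add_right _ _)

section
variable {n : ℕ} {x : Fin n → Bool} {l : List ℕ}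

theorem mem_ones_iff_of_ofFn_eq (hl : ∀ a ∈ l, 0 < a) (hx : List.ofFn x = blockWord l) (j : Fin n) :
    j ∈ ones x ↔ ∃ i < l.length, (j : ℕ) + 1 = (l.take (i + 1)).sum := by
  rw [← getElem?_blockWord_eq_true_iff hl, ← hx]
  simp [ones]

theorem exists_embedding_ones (hl : ∀ a ∈ l, 0 < a) (hx : List.ofFn x = blockWord l) :
    ∃ e : Fin l.length → Fin n, StrictMono e ∧ (∀ i, ((e i : ℕ) : ℤ) + 1 = (l.take (i + 1)).sum) ∧
      ones x = Finset.univ.image e := by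
  have hn : n = l.sum := by rw [← length_blockWord hl, ← hx, List.length_ofFn]
  have hpos : ∀ i : Fin l.length, 0 < (l.take (i + 1)).sum ∧ (l.take (i + 1)).sum ≤ n := by
    intro i
    refine ⟨(Nat.zero_le _).trans_lt (sum_take_lt_sum_take hl (Nat.lt_succ_self i) i.2), ?_⟩
    rw [hn]
    conv_rhs => rw [← List.take_append_drop (i + 1) l, List.sum_append]
    omega
  refine ⟨fun i => ⟨(l.take (i + 1)).sum - 1, by have := hpos i; omega⟩, ?_, ?_, ?_⟩
  · intro i j hij
    have h1 := hpos i
    have h2 := sum_take_lt_sum_take hl (show (i : ℕ) + 1 < j + 1 from Nat.succ_lt_succ hij) j.2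
    simp only [Fin.mk_lt_mk]
    omega
  · intro i
    have := hpos i
    simp only
    omega
  · ext j
    rw [mem_ones_iff_of_ofFn_eq hl hx]
    simp only [Finset.mem_image, Finset.mem_univ, true_and]
    constructor
    · rintro ⟨i, hi, hj⟩
      exact ⟨⟨i, hi⟩, Fin.ext (by simp only; omega)⟩
    · rintro ⟨i, rfl⟩
      have := hpos i
      exact ⟨i, i.2, by simp only; omega⟩

theorem weight_eq_length (hl : ∀ a ∈ l, 0 < a) (hx : List.ofFn x = blockWord l) :
    weight x = l.length := by
  obtain ⟨e, he, -, h⟩ := exists_embedding_ones hl hx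
  rw [weight, h, Finset.card_image_of_injective _ he.injective, Finset.card_univ, Fintype.card_fin]

theorem positions_eq_sum_take (hl : ∀ a ∈ l, 0 < a) (hx : List.ofFn x = blockWord l) {W : ℕ}
    (h : weight x = W) (i : Fin W) : positions x h i = ((l.take (i + 1)).sum : ℕ) := by
  obtain rfl : W = l.length := h.symm.trans (weight_eq_length hl hx)
  obtain ⟨e, he, he1, he2⟩ := exists_embedding_ones hl hx
  have := Finset.orderEmbOfFin_unique (s := ones x) h (f := e)
    (fun i => by rw [he2]; exact Finset.mem_image_of_mem _ (Finset.mem_univ _)) he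
  rw [positions, ← this]
  exact he1 i

end

end BitShift

namespace BitShift

theorem finite_setOf_list_sum_eq {A : Set ℕ} (hA : ∀ a ∈ A, 0 < a) (n : ℕ) :
    {l : List ℕ | (∀ a ∈ l, a ∈ A) ∧ l.sum = n}.Finite := by
  refine (Set.finite_range fun c : Composition n => c.blocks).subset ?_
  rintro l ⟨hl, hs⟩
  exact ⟨⟨l, fun h => hA _ (hl _ h), hs⟩, rfl⟩

/-- The lists of block lengths with sum `n`. -/
noncomputable def blockLists (d : ℕ) (k : ℕ∞) (n : ℕ) : Finset (List ℕ) :=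
  (finite_setOf_list_sum_eq (fun _ => pos_of_mem_blockLengths (d := d) (k := k)) n).toFinset

variable {d : ℕ} {k : ℕ∞} {n : ℕ} {ρ : ℝ} {l : List ℕ}

theorem mem_blockLists : l ∈ blockLists d k n ↔ (∀ a ∈ l, a ∈ blockLengths d k) ∧ l.sum = n := by
  simp [blockLists]

theorem pos_of_mem_blockLists (hl : l ∈ blockLists d k n) : ∀ a ∈ l, 0 < a :=
  fun _ ha => pos_of_mem_blockLengths ((mem_blockLists.1 hl).1 _ ha)

theorem card_mul_pow_le_one {A : Set ℕ} (hA : ∀ a ∈ A, 0 < a) {r : ℝ} (hr : 0 ≤ r)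
    (hsum : ∀ s : Finset ℕ, (∀ a ∈ s, a ∈ A) → ∑ a ∈ s, r ^ a ≤ 1) (n : ℕ) (T : Finset (List ℕ))
    (hT : ∀ l ∈ T, (∀ a ∈ l, a ∈ A) ∧ l.sum = n) : (T.card : ℝ) * r ^ n ≤ 1 := by
  classical
  induction n using Nat.strong_induction_on generalizing T with
  | _ n ih =>
  have hcons : ∀ l ∈ T, n ≠ 0 → ∃ a l', l = a :: l' := by
    intro l hl hn
    cases l with
    | nil => exact absurd (hT _ hl).2.symm hn
    | cons a l => exact ⟨a, l, rfl⟩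
  rcases eq_or_ne n 0 with rfl | hn
  · have hsub : T ⊆ {[]} := by
      intro l hl
      obtain ⟨h1, h2⟩ := hT l hl
      cases l with
      | nil => simp
      | cons a l =>
        have := hA a (h1 a (by simp))
        simp at h2
        omega
    have : (T.card : ℝ) ≤ 1 := by exact_mod_cast Finset.card_le_card hsub
    simpa using this
  · have hfib : ∀ a ∈ T.image List.headI, a ∈ A ∧
        ((T.filter fun l => l.headI = a).card : ℝ) * r ^ n ≤ r ^ a := by
      intro a ha
      obtain ⟨l, hl, rfl⟩ := Finset.mem_image.1 ha
      obtain ⟨a, l, rfl⟩ := hcons l hl hn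
      obtain ⟨h1, h2⟩ := hT _ hl
      have haA := h1 a (by simp)
      have ha0 := hA a haA
      rw [List.sum_cons] at h2
      refine ⟨haA, ?_⟩
      simp only [List.headI_cons]
      set S := T.filter fun l => l.headI = a with hS
      have hinj : Set.InjOn List.tail (S : Set (List ℕ)) := by
        intro u hu v hv huv
        simp only [hS, Finset.coe_filter, Set.mem_ofPred_eq] at hu hv
        obtain ⟨b, u, rfl⟩ := hcons u hu.1 hn
        obtain ⟨c, v, rfl⟩ := hcons v hv.1 hn
        simp only [List.headI_cons, List.tail_cons] at hu hv huv
        rw [hu.2, hv.2, huv]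
      have := ih (n - a) (by omega) (S.image List.tail) (by
        intro v hv
        obtain ⟨u, hu, rfl⟩ := Finset.mem_image.1 hv
        rw [hS, Finset.mem_filter] at hu
        obtain ⟨b, u, rfl⟩ := hcons u hu.1 hn
        obtain ⟨h3, h4⟩ := hT _ hu.1
        have h5 : b = a := hu.2
        rw [List.sum_cons] at h4
        exact ⟨fun c hc => h3 c (List.mem_cons_of_mem _ hc), by simp only [List.tail_cons]; omega⟩)
      rw [Finset.card_image_of_injOn hinj] at this
      calc (S.card : ℝ) * r ^ n = (S.card : ℝ) * r ^ (n - a) * r ^ a := by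
            rw [mul_assoc, ← pow_add, Nat.sub_add_cancel (by omega)]
        _ ≤ 1 * r ^ a := by gcongr
        _ = r ^ a := one_mul _
    rw [Finset.card_eq_sum_card_image List.headI T, Nat.cast_sum, Finset.sum_mul]
    exact (Finset.sum_le_sum fun a ha => (hfib a ha).2).trans (hsum _ fun a ha => (hfib a ha).1)

theorem sum_pow_le_of_hasSum {r s : ℝ} (hr : 0 ≤ r)
    (h : HasSum (fun i : blockLengths d k => r ^ (i : ℕ)) s) (S : Finset ℕ)
    (hS : ∀ a ∈ S, a ∈ blockLengths d k) : ∑ a ∈ S, r ^ a ≤ s := by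
  classical
  rw [← Finset.sum_subtype_of_mem (p := (· ∈ blockLengths d k)) (fun a => r ^ a) hS]
  exact sum_le_hasSum _ (fun i _ => pow_nonneg hr _) h

theorem card_blockLists_mul_pow_le_one (h : IsPositiveRoot d k ρ) (n : ℕ) :
    ((blockLists d k n).card : ℝ) * ρ ^ n ≤ 1 :=
  card_mul_pow_le_one (fun _ => pos_of_mem_blockLengths) h.1.le
    (sum_pow_le_of_hasSum h.1.le h.2) n _ fun _ hl => mem_blockLists.1 hl

theorem exists_pos_le_of_finset {ι : Type*} (s : Finset ι) (f : ι → ℝ) (hf : ∀ i ∈ s, 0 < f i) :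
    ∃ c > 0, ∀ i ∈ s, c ≤ f i := by
  classical
  induction s using Finset.induction_on with
  | empty => exact ⟨1, one_pos, by simp⟩
  | insert a s _ ih =>
    obtain ⟨c, hc, h⟩ := ih fun i hi => hf i (Finset.mem_insert_of_mem hi)
    refine ⟨min c (f a), lt_min hc (hf a (Finset.mem_insert_self _ _)), fun i hi => ?_⟩
    rcases Finset.mem_insert.1 hi with rfl | hi
    · exact min_le_right _ _
    · exact (min_le_left _ _).trans (h i hi)

/-- A sequence that satisfies a linear recurrence inequality grows at least geometrically. -/
theorem exists_pos_le_mul_pow_of_recurrence {ι : Type*} (s : Finset ι) (e : ι → ℕ)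
    (he : ∀ i ∈ s, 0 < e i) (u : ℕ → ℝ) (hρ : 0 < ρ) (hsum : ∑ i ∈ s, ρ ^ e i = 1) (n₁ : ℕ)
    (hrec : ∀ n ≥ n₁, ∑ i ∈ s, u (n - e i) ≤ u n) (n₀ : ℕ) (hu : ∀ n ≥ n₀, 0 < u n) :
    ∃ c > 0, ∀ n ≥ n₀, c ≤ u n * ρ ^ n := by
  set m := n₀ + n₁ + s.sup e with hm
  obtain ⟨c, hc, h⟩ := exists_pos_le_of_finset (Finset.Ico n₀ m) (fun n => u n * ρ ^ n)
    fun n hn => mul_pos (hu n (Finset.mem_Ico.1 hn).1) (pow_pos hρ n)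
  refine ⟨c, hc, fun n => ?_⟩
  induction n using Nat.strong_induction_on with
  | _ n ih =>
  intro hn
  by_cases hnm : n < m
  · exact h n (Finset.mem_Ico.2 ⟨hn, hnm⟩)
  · calc c = ∑ i ∈ s, c * ρ ^ e i := by rw [← Finset.mul_sum, hsum, mul_one]
      _ ≤ ∑ i ∈ s, u (n - e i) * ρ ^ n := by
        refine Finset.sum_le_sum fun i hi => ?_
        have h1 : e i ≤ s.sup e := Finset.le_sup hi
        have h2 := he i hi
        have h3 := ih (n - e i) (by omega) (by omega)
        calc c * ρ ^ e i ≤ u (n - e i) * ρ ^ (n - e i) * ρ ^ e i := by gcongr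
          _ = u (n - e i) * ρ ^ n := by
            rw [mul_assoc, ← pow_add, Nat.sub_add_cancel (by omega)]
      _ = (∑ i ∈ s, u (n - e i)) * ρ ^ n := by rw [Finset.sum_mul]
      _ ≤ u n * ρ ^ n := by
        gcongr
        exact hrec n (by omega)

theorem card_blockLists_pos (hdk : (d : ℕ∞) < k) {n : ℕ} (hn : (d + 1) * (d + 1) ≤ n) :
    0 < (blockLists d k n).card := by
  refine Finset.card_pos.2 ⟨List.replicate (n / (d + 1) - n % (d + 1)) (d + 1) ++
    List.replicate (n % (d + 1)) (d + 2), mem_blockLists.2 ⟨?_, ?_⟩⟩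
  · intro a ha
    rcases List.mem_append.1 ha with ha | ha
    · rw [List.eq_of_mem_replicate ha]
      exact add_one_mem_blockLengths hdk
    · rw [List.eq_of_mem_replicate ha]
      exact add_two_mem_blockLengths hdk
  · have h1 : d + 1 ≤ n / (d + 1) := (Nat.le_div_iff_mul_le (by omega)).2 hn
    have h2 : n % (d + 1) < d + 1 := Nat.mod_lt _ (by omega)
    have h3 := Nat.div_add_mod n (d + 1)
    obtain ⟨p, hp⟩ : ∃ p, n / (d + 1) = n % (d + 1) + p := ⟨_, (Nat.add_sub_of_le (by omega)).symm⟩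
    rw [hp] at h3 ⊢
    simp only [List.sum_append, List.sum_replicate, smul_eq_mul, Nat.add_sub_cancel_left]
    nlinarith

theorem cons_mem_blockLists {a : ℕ} (ha : a ∈ blockLengths d k) (han : a ≤ n)
    (hl : l ∈ blockLists d k (n - a)) : a :: l ∈ blockLists d k n := by
  obtain ⟨h1, h2⟩ := mem_blockLists.1 hl
  refine mem_blockLists.2 ⟨?_, by rw [List.sum_cons, h2]; omega⟩
  simpa using ⟨ha, h1⟩

theorem sum_card_blockLists_le (s : Finset ℕ) (hs : ∀ a ∈ s, a ∈ blockLengths d k)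
    (hn : ∀ a ∈ s, a ≤ n) :
    ∑ a ∈ s, (blockLists d k (n - a)).card ≤ (blockLists d k n).card := by
  classical
  calc ∑ a ∈ s, (blockLists d k (n - a)).card
      = ∑ a ∈ s, ((blockLists d k (n - a)).image (List.cons a)).card := by
        refine Finset.sum_congr rfl fun a _ => ?_
        rw [Finset.card_image_of_injective _ (List.cons_injective)]
    _ = (s.biUnion fun a => (blockLists d k (n - a)).image (List.cons a)).card := by
        rw [Finset.card_biUnion]
        intro a _ b _ hab
        refine Finset.disjoint_left.2 fun l hl hl' => hab ?_
        obtain ⟨u, -, rfl⟩ := Finset.mem_image.1 hl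
        obtain ⟨v, -, hv⟩ := Finset.mem_image.1 hl'
        exact (List.cons.inj hv).1.symm
    _ ≤ (blockLists d k n).card := by
        refine Finset.card_le_card fun l hl => ?_
        obtain ⟨a, ha, hl⟩ := Finset.mem_biUnion.1 hl
        obtain ⟨u, hu, rfl⟩ := Finset.mem_image.1 hl
        exact cons_mem_blockLists (hs a ha) (hn a ha) hu

theorem card_blockLists_top_le (hn : d + 2 ≤ n) :
    (blockLists d ⊤ (n - 1)).card + (blockLists d ⊤ (n - (d + 1))).card
      ≤ (blockLists d ⊤ n).card := by
  classical
  set f : List ℕ → List ℕ := fun l => (l.headI + 1) :: l.tail with hf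
  have hcons : ∀ l ∈ blockLists d ⊤ (n - 1), ∃ a u, l = a :: u := by
    intro l hl
    cases l with
    | nil =>
      have := (mem_blockLists.1 hl).2
      simp at this
      omega
    | cons a u => exact ⟨a, u, rfl⟩
  have hinj : Set.InjOn f (blockLists d ⊤ (n - 1) : Set (List ℕ)) := by
    intro u hu v hv huv
    obtain ⟨a, u, rfl⟩ := hcons u hu
    obtain ⟨b, v, rfl⟩ := hcons v hv
    simpa [hf] using huv
  rw [← Finset.card_image_of_injOn hinj,
    ← Finset.card_image_of_injective (blockLists d ⊤ (n - (d + 1)))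
      (List.cons_injective (a := d + 1)), ← Finset.card_union_of_disjoint]
  · refine Finset.card_le_card fun l hl => ?_
    rcases Finset.mem_union.1 hl with hl | hl
    · obtain ⟨u, hu, rfl⟩ := Finset.mem_image.1 hl
      obtain ⟨a, u, rfl⟩ := hcons u hu
      obtain ⟨h1, h2⟩ := mem_blockLists.1 hu
      rw [List.sum_cons] at h2
      refine mem_blockLists.2 ⟨?_, by simp [hf]; omega⟩
      intro b hb
      rcases List.mem_cons.1 hb with rfl | hb
      · refine ⟨?_, by simp⟩
        exact (h1 a (by simp)).1.trans (Nat.le_succ _)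
      · exact h1 b (List.mem_cons_of_mem _ hb)
    · obtain ⟨u, hu, rfl⟩ := Finset.mem_image.1 hl
      exact cons_mem_blockLists ⟨le_rfl, by simp⟩ (by omega) hu
  · refine Finset.disjoint_left.2 fun l hl hl' => ?_
    obtain ⟨u, hu, rfl⟩ := Finset.mem_image.1 hl
    obtain ⟨v, hv, hv'⟩ := Finset.mem_image.1 hl'
    obtain ⟨a, u, rfl⟩ := hcons u hu
    have h1 := ((mem_blockLists.1 hu).1 a (by simp)).1
    have h2 := (List.cons.inj hv').1
    simp at h2
    omega

theorem IsPositiveRoot.add_pow_eq_one (h : IsPositiveRoot d ⊤ ρ) : ρ + ρ ^ (d + 1) = 1 := by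
  have hρ1 := h.lt_one (ENat.natCast_lt_top d)
  have hgeo : HasSum (fun i : ℕ => ρ ^ (i + (d + 1))) (ρ ^ (d + 1) * (1 - ρ)⁻¹) := by
    rw [show (fun i : ℕ => ρ ^ (i + (d + 1))) = fun i => ρ ^ (d + 1) * ρ ^ i from
      funext fun i => by ring]
    exact (hasSum_geometric_of_lt_one h.1.le hρ1).mul_left (ρ ^ (d + 1))
  let e : ℕ ≃ blockLengths d ⊤ :=
    { toFun := fun i => ⟨i + (d + 1), by omega, by simp⟩
      invFun := fun i => i - (d + 1)
      left_inv := fun i => by simp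
      right_inv := fun i => Subtype.ext (Nat.sub_add_cancel i.2.1) }
  have h2 := (e.hasSum_iff (f := fun i : blockLengths d ⊤ => ρ ^ (i : ℕ))).2 h.2
  have h3 := hgeo.unique h2
  have h4 : 1 - ρ ≠ 0 := by linarith
  field_simp at h3
  linarith

theorem exists_pos_le_card_blockLists (hdk : (d : ℕ∞) < k) (h : IsPositiveRoot d k ρ) :
    ∃ c > 0, ∀ n ≥ (d + 1) * (d + 1), c ≤ ((blockLists d k n).card : ℝ) * ρ ^ n := by
  have hpos : ∀ n ≥ (d + 1) * (d + 1), (0 : ℝ) < (blockLists d k n).card := fun n hn => by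
    exact_mod_cast card_blockLists_pos hdk hn
  cases k with
  | top =>
    refine exists_pos_le_mul_pow_of_recurrence Finset.univ ![1, d + 1] ?_ _ h.1 ?_ (d + 2) ?_ _ hpos
    · intro i _
      fin_cases i <;> simp
    · simpa [Fin.sum_univ_two] using h.add_pow_eq_one
    · intro n hn
      simp only [Fin.sum_univ_two, Matrix.cons_val_zero, Matrix.cons_val_one]
      exact_mod_cast card_blockLists_top_le hn
  | coe k =>
    have hmem : ∀ a, a ∈ Finset.Icc (d + 1) (k + 1) ↔ a ∈ blockLengths d (k : ℕ∞) := by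
      intro a
      rw [Finset.mem_Icc]
      refine and_congr Iff.rfl ?_
      norm_cast
    refine exists_pos_le_mul_pow_of_recurrence (Finset.Icc (d + 1) (k + 1)) id ?_ _ h.1 ?_ (k + 1)
      ?_ _ hpos
    · intro i hi
      exact pos_of_mem_blockLengths ((hmem i).1 hi)
    · exact (Finset.hasSum (Finset.Icc (d + 1) (k + 1)) (fun i => ρ ^ i)).unique
        (((Equiv.subtypeEquivRight hmem).hasSum_iff
          (f := fun i : blockLengths d (k : ℕ∞) => ρ ^ (i : ℕ))).2 h.2)
    · intro n hn
      exact_mod_cast sum_card_blockLists_le (d := d) (k := k) (n := n) _ (fun a ha => (hmem a).1 ha)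
        fun a ha => (Finset.mem_Icc.1 ha).2.trans hn

end BitShift

namespace BitShift

open Polynomial in
/-- The monic polynomial over `ZMod p` with the roots `-1, -2, …, -W` of multiplicities
`u 0, u 1, …`. -/
noncomputable def locator (p : ℕ) {W : ℕ} (u : Fin W → ℕ) : (ZMod p)[X] :=
  ∏ i : Fin W, (X + C (((i : ℕ) + 1 : ℕ) : ZMod p)) ^ u i

section
open Polynomial

variable {p W : ℕ}

theorem locator_add (u v : Fin W → ℕ) : locator p (u + v) = locator p u * locator p v := by
  simp only [locator, Pi.add_apply, pow_add, Finset.prod_mul_distrib]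

theorem monic_locator (u : Fin W → ℕ) : (locator p u).Monic :=
  monic_prod_of_monic _ _ fun _ _ => (monic_X_add_C _).pow _

theorem natDegree_locator [Fact p.Prime] (u : Fin W → ℕ) : (locator p u).natDegree = ∑ i, u i := by
  rw [locator, natDegree_prod_of_monic _ _ fun i _ => (monic_X_add_C _).pow _]
  refine Finset.sum_congr rfl fun i _ => ?_
  rw [natDegree_pow, natDegree_X_add_C, mul_one]

theorem natCast_eq_natCast_iff_of_lt {a b : ℕ} (ha : a < p) (hb : b < p) :
    (a : ZMod p) = b ↔ a = b := by
  rw [ZMod.natCast_eq_natCast_iff', Nat.mod_eq_of_lt ha, Nat.mod_eq_of_lt hb]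

theorem isCoprime_X_pow_locator [Fact p.Prime] (hW : W < p) (t : ℕ) (u : Fin W → ℕ) :
    IsCoprime (X ^ t : (ZMod p)[X]) (locator p u) := by
  refine IsCoprime.prod_right fun i _ => IsCoprime.pow ?_
  have hne : (((i : ℕ) + 1 : ℕ) : ZMod p) ≠ 0 := by
    rw [← Nat.cast_zero, Ne, natCast_eq_natCast_iff_of_lt (by omega) (by omega)]
    omega
  refine ⟨-C ((((i : ℕ) + 1 : ℕ) : ZMod p)⁻¹), C ((((i : ℕ) + 1 : ℕ) : ZMod p)⁻¹), ?_⟩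
  rw [mul_add, ← C_mul, inv_mul_cancel₀ hne, C_1]
  ring

theorem eval_locator_eq_zero_iff [Fact p.Prime] (hW : W < p) (u : Fin W → ℕ) (i : Fin W) :
    (locator p u).eval (-(((i : ℕ) + 1 : ℕ) : ZMod p)) = 0 ↔ u i ≠ 0 := by
  rw [locator, eval_prod, Finset.prod_eq_zero_iff]
  simp only [Finset.mem_univ, true_and, eval_pow, eval_add, eval_X, eval_C, pow_eq_zero_iff',
    neg_add_eq_zero]
  constructor
  · rintro ⟨j, hj, hu⟩
    rw [natCast_eq_natCast_iff_of_lt (by omega) (by omega)] at hj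
    rwa [show i = j from Fin.ext (by omega)]
  · exact fun h => ⟨i, rfl, h⟩

theorem eq_of_locator_coeff_eq [Fact p.Prime] {t : ℕ} (hW : W < p) {u v : Fin W → ℕ}
    (hcoeff : ∀ j < t, (locator p u).coeff j = (locator p v).coeff j)
    (hsum : ((∑ i, u i : ℕ) : ZMod (2 * t + 1)) = (∑ i, v i : ℕ))
    (hdist : ∑ i, |(u i : ℤ) - v i| ≤ 2 * t) : u = v := by
  set m : Fin W → ℕ := fun i => min (u i) (v i) with hm
  set e : Fin W → ℕ := fun i => u i - v i with he
  set e' : Fin W → ℕ := fun i => v i - u i with he'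
  have hu : u = m + e := by
    funext i
    simp only [hm, he, Pi.add_apply]
    omega
  have hv : v = m + e' := by
    funext i
    simp only [hm, he', Pi.add_apply]
    omega
  have habs : ∑ i, e i + ∑ i, e' i ≤ 2 * t := by
    zify
    rw [← Finset.sum_add_distrib]
    refine le_trans (Finset.sum_le_sum fun i _ => ?_) hdist
    simp only [he, he']
    rcases abs_cases ((u i : ℤ) - v i) with h | h <;> omega
  have hdeg : ∑ i, e i = ∑ i, e' i := by
    rw [hu, hv] at hsum
    simp only [Pi.add_apply, Finset.sum_add_distrib, Nat.cast_add, add_right_inj] at hsum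
    exact (natCast_eq_natCast_iff_of_lt (by omega) (by omega)).1 hsum
  have hdvd : (X ^ t : (ZMod p)[X]) ∣ locator p e - locator p e' := by
    refine (isCoprime_X_pow_locator hW t m).dvd_of_dvd_mul_left ?_
    rw [mul_sub, ← locator_add, ← locator_add, ← hu, ← hv, X_pow_dvd_iff]
    intro j hj
    rw [coeff_sub, hcoeff j hj, sub_self]
  have hloc : locator p e = locator p e' := by
    rw [← sub_eq_zero]
    refine eq_zero_of_dvd_of_degree_lt hdvd ?_
    have h1 : (locator p e).degree = (∑ i, e i : ℕ) := by
      rw [degree_eq_natDegree (monic_locator e).ne_zero, natDegree_locator]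
    have h2 : (locator p e').degree = (∑ i, e i : ℕ) := by
      rw [degree_eq_natDegree (monic_locator e').ne_zero, natDegree_locator, hdeg]
    refine (degree_sub_lt_left (h1.trans h2.symm) (monic_locator e).ne_zero
      ((monic_locator e).leadingCoeff.trans (monic_locator e').leadingCoeff.symm)).trans_le ?_
    rw [h1, degree_X_pow]
    exact_mod_cast (by omega : ∑ i, e i ≤ t)
  funext i
  have h1 := eval_locator_eq_zero_iff hW e i
  rw [hloc, eval_locator_eq_zero_iff hW e' i] at h1
  simp only [he, he'] at h1
  omega

end

/-- The positions of the 1's of a string of weight `W` as natural numbers. -/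
def natPositions {n W : ℕ} (x : Fin n → Bool) (h : weight x = W) (i : Fin W) : ℕ :=
  ((ones x).orderEmbOfFin h i : Fin n) + 1

theorem positions_eq_natPositions {n W : ℕ} (x : Fin n → Bool) (h : weight x = W) (i : Fin W) :
    positions x h i = natPositions x h i := by
  simp [positions, natPositions]

theorem eq_of_natPositions_eq {n W : ℕ} {x y : Fin n → Bool} (hx : weight x = W)
    (hy : weight y = W) (h : natPositions x hx = natPositions y hy) : x = y := by
  have h1 : ones x = ones y := by
    rw [← Finset.coe_inj, ← Finset.range_orderEmbOfFin _ hx, ← Finset.range_orderEmbOfFin _ hy]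
    congr 1
    funext i
    have := congrFun h i
    simp only [natPositions] at this
    exact Fin.ext (by omega)
  funext i
  have h2 : i ∈ ones x ↔ i ∈ ones y := by rw [h1]
  simp only [ones, Finset.mem_filter, Finset.mem_univ, true_and] at h2
  exact Bool.eq_iff_iff.2 h2

/-- The syndrome of a string: the first `t` coefficients of the locator polynomial of its vector
of positions, and the sum of the positions modulo `2t + 1`. -/
noncomputable def syndrome {n : ℕ} (p t : ℕ) (x : Fin n → Bool) :
    (Fin t → ZMod p) × ZMod (2 * t + 1) :=
  (fun j => (locator p (natPositions x rfl)).coeff j, (∑ i, natPositions x rfl i : ℕ))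

theorem syndrome_eq {n W : ℕ} (p t : ℕ) (x : Fin n → Bool) (h : weight x = W) :
    syndrome p t x =
      (fun j : Fin t => (locator p (natPositions x h)).coeff j,
        ((∑ i, natPositions x h i : ℕ) : ZMod (2 * t + 1))) := by
  subst h
  rfl

theorem correctsShifts_of_syndrome_eq {n p t : ℕ} [Fact p.Prime] (hp : n < p)
    (C : Finset (Fin n → Bool)) (s : (Fin t → ZMod p) × ZMod (2 * t + 1))
    (hC : ∀ x ∈ C, syndrome p t x = s) : CorrectsShifts t C := by
  intro x hx y hy hxy W hWx hWy f g hf hg heq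
  have hs := (hC x hx).trans (hC y hy).symm
  rw [syndrome_eq p t x hWx, syndrome_eq p t y hWy, Prod.mk.injEq] at hs
  have hWn : W ≤ n := by
    rw [← hWx, weight]
    simpa using Finset.card_le_univ (ones x)
  refine hxy (eq_of_natPositions_eq hWx hWy (eq_of_locator_coeff_eq (hWn.trans_lt hp)
    (fun j hj => congrFun hs.1 ⟨j, hj⟩) hs.2 ?_))
  calc ∑ i, |(natPositions x hWx i : ℤ) - natPositions y hWy i|
      ≤ ∑ i, (|f i| + |g i|) := by
        refine Finset.sum_le_sum fun i _ => ?_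
        have := congrFun heq i
        simp only [Pi.add_apply, positions_eq_natPositions] at this
        rw [show (natPositions x hWx i : ℤ) - natPositions y hWy i = g i - f i by linarith,
          add_comm]
        exact abs_sub _ _
    _ = ∑ i, |f i| + ∑ i, |g i| := Finset.sum_add_distrib
    _ ≤ 2 * t := by linarith

theorem le_maxCodeSize {d : ℕ} {k : ℕ∞} {n t : ℕ} {C : Finset (Fin n → Bool)}
    (hC : ∀ x ∈ C, x ∈ inputs d k n) (hCt : CorrectsShifts t C) :
    C.card ≤ maxCodeSize d k n t := by
  classical
  unfold maxCodeSize
  exact Finset.le_sup (f := Finset.card)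
    (Finset.mem_filter.2 ⟨Finset.mem_univ _, hC, hCt⟩)

theorem exists_code_card_eq_maxCodeSize (d : ℕ) (k : ℕ∞) (n t : ℕ) :
    ∃ C : Finset (Fin n → Bool), (∀ x ∈ C, x ∈ inputs d k n) ∧ CorrectsShifts t C ∧
      C.card = maxCodeSize d k n t := by
  classical
  unfold maxCodeSize
  obtain ⟨C, hC, h⟩ := Finset.exists_mem_eq_sup
    ((Finset.univ : Finset (Finset (Fin n → Bool))).filter fun C =>
      (∀ x ∈ C, x ∈ inputs d k n) ∧ CorrectsShifts t C)
    ⟨∅, Finset.mem_filter.2 ⟨Finset.mem_univ _, by simp [CorrectsShifts]⟩⟩ Finset.card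
  have hC := (Finset.mem_filter.1 hC).2
  refine ⟨C, hC.1, hC.2, ?_⟩
  rw [← h]

open Classical in
theorem card_blockLists_le_card_inputs (d : ℕ) (k : ℕ∞) (n : ℕ) :
    (blockLists d k n).card ≤ (Finset.univ.filter fun x : Fin n → Bool => x ∈ inputs d k n).card := by
  have hword : ∀ l ∈ blockLists d k n,
      List.ofFn (fun i : Fin n => (blockWord l).getD i false) = blockWord l := by
    intro l hl
    have hlen : (blockWord l).length = n := by
      rw [length_blockWord (pos_of_mem_blockLists hl), (mem_blockLists.1 hl).2]
    refine List.ext_getElem (by simp [hlen]) fun i h1 h2 => ?_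
    simp [List.getElem?_eq_getElem h2]
  refine Finset.card_le_card_of_injOn (fun l i => (blockWord l).getD i false) ?_ ?_
  · intro l hl
    refine Finset.mem_coe.2 (Finset.mem_filter.2 ⟨Finset.mem_univ _, ?_⟩)
    exact mem_kstar_blocks_iff.2 ⟨l, (mem_blockLists.1 hl).1, hword l hl⟩
  · intro l hl l' hl' h
    refine blockWord_injective (pos_of_mem_blockLists hl) (pos_of_mem_blockLists hl') ?_
    rw [← hword l hl, ← hword l' hl']
    exact congrArg _ h

theorem card_blockLists_le_maxCodeSize (d : ℕ) (k : ℕ∞) {n : ℕ} (t : ℕ) (hn : n ≠ 0) :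
    (blockLists d k n).card ≤ maxCodeSize d k n t * ((2 * n) ^ t * (2 * t + 1)) := by
  classical
  obtain ⟨p, hp, hnp, hp2⟩ := Nat.exists_prime_lt_and_le_two_mul n hn
  have : Fact p.Prime := ⟨hp⟩
  refine (card_blockLists_le_card_inputs d k n).trans ?_
  refine (Finset.card_le_mul_card_image_of_maps_to (f := syndrome p t) (t := Finset.univ)
    (fun _ _ => Finset.mem_univ _) (maxCodeSize d k n t) fun s _ => ?_).trans ?_
  · refine le_maxCodeSize (fun x hx => ?_) (correctsShifts_of_syndrome_eq hnp _ s fun x hx => ?_)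
    · exact (Finset.mem_filter.1 (Finset.mem_filter.1 hx).1).2
    · exact (Finset.mem_filter.1 hx).2
  · gcongr
    rw [Finset.card_univ, Fintype.card_prod, Fintype.card_fun, Fintype.card_fin, ZMod.card,
      ZMod.card]
    gcongr

end BitShift

namespace BitShift

/-- The number of pairs `(d+1, d+2)` in the decomposition of a list into consecutive pairs. -/
def switchCount (d : ℕ) : List ℕ → ℕ
  | a :: b :: l => (if a = d + 1 ∧ b = d + 2 then 1 else 0) + switchCount d l
  | _ => 0

/-- The lists that arise from a list by replacing exactly `s` of the pairs `(d+1, d+2)` in its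
decomposition into consecutive pairs by `(d+2, d+1)`. -/
def switches (d : ℕ) : ℕ → List ℕ → Finset (List ℕ)
  | 0, l => {l}
  | s + 1, a :: b :: l => (switches d (s + 1) l).image (fun u => a :: b :: u) ∪
      if a = d + 1 ∧ b = d + 2 then (switches d s l).image (fun u => (d + 2) :: (d + 1) :: u) else ∅
  | _ + 1, _ => ∅

theorem card_switches (d : ℕ) : ∀ (s : ℕ) (l : List ℕ),
    (switches d s l).card = (switchCount d l).choose s
  | 0, l => by simp [switches]
  | s + 1, [] => by simp [switches, switchCount]
  | s + 1, [a] => by simp [switches, switchCount]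
  | s + 1, a :: b :: l => by
    have h1 := card_switches d (s + 1) l
    have h2 := card_switches d s l
    have hinj : ∀ a b : ℕ, Function.Injective fun u : List ℕ => a :: b :: u :=
      fun a b u v h => by simpa using h
    rw [switches, switchCount]
    split_ifs with h
    · rw [Finset.card_union_of_disjoint, Finset.card_image_of_injective _ (hinj _ _),
        Finset.card_image_of_injective _ (hinj _ _), h1, h2, add_comm 1, Nat.choose_succ_succ,
        add_comm]
      refine Finset.disjoint_left.2 fun u hu hu' => ?_
      obtain ⟨v, -, rfl⟩ := Finset.mem_image.1 hu
      obtain ⟨v', -, hv'⟩ := Finset.mem_image.1 hu'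
      have := (List.cons.inj hv').1
      omega
    · rw [Finset.union_empty, Finset.card_image_of_injective _ (hinj _ _), h1, zero_add]

/-- The `ℓ¹`-distance of the vectors of partial sums of two lists. -/
def partialSumDist (z l : List ℕ) : ℤ :=
  ∑ i ∈ Finset.range l.length, |((z.take (i + 1)).sum : ℤ) - (l.take (i + 1)).sum|

theorem partialSumDist_cons_cons (a b a' b' : ℕ) (z l : List ℕ) (h : a + b = a' + b') :
    partialSumDist (a :: b :: z) (a' :: b' :: l) = |(a : ℤ) - a'| + partialSumDist z l := by
  have h' : (a : ℤ) + b = a' + b' := by exact_mod_cast h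
  simp only [partialSumDist, List.length_cons, Finset.sum_range_succ', List.take_succ_cons,
    List.sum_cons, List.take_zero, List.sum_nil]
  push_cast
  simp only [← add_assoc, h', add_sub_add_left_eq_sub]
  simp
  ring

theorem mem_switches_props {d : ℕ} {A : Set ℕ} (h1 : d + 1 ∈ A) (h2 : d + 2 ∈ A) :
    ∀ {s : ℕ} {l z : List ℕ}, z ∈ switches d s l → (∀ a ∈ l, a ∈ A) →
      z.length = l.length ∧ z.sum = l.sum ∧ (∀ a ∈ z, a ∈ A) ∧ partialSumDist z l ≤ s
  | 0, l, z, hz, hl => by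
    rw [switches, Finset.mem_singleton] at hz
    subst hz
    exact ⟨rfl, rfl, hl, by simp [partialSumDist]⟩
  | s + 1, [], z, hz, hl => by simp [switches] at hz
  | s + 1, [a], z, hz, hl => by simp [switches] at hz
  | s + 1, a :: b :: l, z, hz, hl => by
    have hl' : ∀ c ∈ l, c ∈ A := fun c hc => hl c (by simp [hc])
    rw [switches, Finset.mem_union] at hz
    rcases hz with hz | hz
    · obtain ⟨u, hu, rfl⟩ := Finset.mem_image.1 hz
      obtain ⟨i1, i2, i3, i4⟩ := mem_switches_props h1 h2 hu hl'
      refine ⟨by simp [i1], by simp [i2], ?_, ?_⟩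
      · simp only [List.mem_cons, forall_eq_or_imp]
        exact ⟨hl a (by simp), hl b (by simp), i3⟩
      · rw [partialSumDist_cons_cons _ _ _ _ _ _ rfl]
        simpa using i4
    · split_ifs at hz with hab
      · obtain ⟨u, hu, rfl⟩ := Finset.mem_image.1 hz
        obtain ⟨i1, i2, i3, i4⟩ := mem_switches_props h1 h2 hu hl'
        obtain ⟨rfl, rfl⟩ := hab
        refine ⟨by simp [i1], by simp [i2]; omega, ?_, ?_⟩
        · simp only [List.mem_cons, forall_eq_or_imp]
          exact ⟨h2, h1, i3⟩
        · rw [partialSumDist_cons_cons _ _ _ _ _ _ (by omega)]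
          push_cast
          rw [show (d : ℤ) + 2 - (d + 1) = 1 by ring, abs_one]
          linarith
      · simp at hz

theorem sum_half_pow_switchCount_le {A : Set ℕ} (hA : ∀ a ∈ A, 0 < a) (d : ℕ) {r q K : ℝ}
    (hr0 : 0 ≤ r) (hr1 : r ≤ 1) (hK0 : 0 ≤ K) (hK : 1 + q * K ≤ K)
    (hq : ∀ P : Finset (ℕ × ℕ), (∀ p ∈ P, p.1 ∈ A ∧ p.2 ∈ A) →
      ∑ p ∈ P, (1 / 2 : ℝ) ^ (if p.1 = d + 1 ∧ p.2 = d + 2 then 1 else 0) * r ^ (p.1 + p.2) ≤ q)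
    (n : ℕ) (T : Finset (List ℕ)) (hT : ∀ l ∈ T, (∀ a ∈ l, a ∈ A) ∧ l.sum = n) :
    (∑ l ∈ T, (1 / 2 : ℝ) ^ switchCount d l) * r ^ n ≤ K := by
  classical
  induction n using Nat.strong_induction_on generalizing T with
  | _ n ih =>
  rw [← Finset.sum_filter_add_sum_filter_not T (fun l => l.length ≤ 1), add_mul]
  refine (add_le_add ?_ ?_).trans hK
  · have hcard : (T.filter fun l => l.length ≤ 1).card ≤ 1 := by
      refine Finset.card_le_one.2 fun u hu v hv => ?_
      simp only [Finset.mem_filter] at hu hv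
      obtain ⟨hu1, hu2⟩ := hT u hu.1
      obtain ⟨hv1, hv2⟩ := hT v hv.1
      match u, v, hu, hv, hu1, hu2, hv1, hv2 with
      | [], [], _, _, _, _, _, _ => rfl
      | [a], [], _, _, hu1, hu2, _, hv2 =>
        have := hA a (hu1 a (by simp))
        simp at hu2 hv2
        omega
      | [], [a], _, _, _, hu2, hv1, hv2 =>
        have := hA a (hv1 a (by simp))
        simp at hu2 hv2
        omega
      | [a], [b], _, _, _, hu2, _, hv2 =>
        simp at hu2 hv2
        rw [hu2, hv2]
      | _ :: _ :: _, _, hu, _, _, _, _, _ => simp at hu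
      | _, _ :: _ :: _, _, hv, _, _, _, _ => simp at hv
    have h1 : ∑ l ∈ T.filter (fun l => l.length ≤ 1), (1 / 2 : ℝ) ^ switchCount d l ≤ 1 := by
      refine (Finset.sum_le_card_nsmul _ _ 1 fun l _ => ?_).trans ?_
      · exact pow_le_one₀ (by norm_num) (by norm_num)
      · rw [nsmul_eq_mul, mul_one]
        exact_mod_cast hcard
    exact mul_le_one₀ h1 (pow_nonneg hr0 _) (pow_le_one₀ hr0 hr1)
  · set T' := T.filter fun l => ¬ l.length ≤ 1 with hT'
    have hcons : ∀ l ∈ T', ∃ a b u, l = a :: b :: u ∧ l ∈ T := by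
      intro l hl
      rw [hT', Finset.mem_filter] at hl
      match l, hl with
      | [], hl => simp at hl
      | [a], hl => simp at hl
      | a :: b :: u, hl => exact ⟨a, b, u, rfl, hl.1⟩
    set g : List ℕ → ℕ × ℕ := fun l => (l.headI, l.tail.headI) with hg
    have hfib : ∀ p ∈ T'.image g, (p.1 ∈ A ∧ p.2 ∈ A) ∧
        (∑ l ∈ T' with g l = p, (1 / 2 : ℝ) ^ switchCount d l) * r ^ n ≤
          (1 / 2 : ℝ) ^ (if p.1 = d + 1 ∧ p.2 = d + 2 then 1 else 0) * r ^ (p.1 + p.2) * K := by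
      intro p hp
      obtain ⟨l, hl, rfl⟩ := Finset.mem_image.1 hp
      obtain ⟨a, b, u, rfl, hlT⟩ := hcons l hl
      obtain ⟨h1, h2⟩ := hT _ hlT
      have ha := h1 a (by simp)
      have hb := h1 b (by simp)
      have ha0 := hA a ha
      have hb0 := hA b hb
      rw [List.sum_cons, List.sum_cons] at h2
      refine ⟨⟨ha, hb⟩, ?_⟩
      simp only [hg, List.headI_cons, List.tail_cons]
      set S := T'.filter fun l => (l.headI, l.tail.headI) = (a, b) with hS
      have hSmem : ∀ l ∈ S, ∃ v, l = a :: b :: v ∧ l ∈ T := by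
        intro l hl
        rw [hS, Finset.mem_filter] at hl
        obtain ⟨a', b', v, rfl, hlT⟩ := hcons l hl.1
        have := hl.2
        simp only [List.headI_cons, List.tail_cons, Prod.mk.injEq] at this
        exact ⟨v, by rw [this.1, this.2], hlT⟩
      have hinj : Set.InjOn (List.drop 2) (S : Set (List ℕ)) := by
        intro l hl l' hl' h
        obtain ⟨v, rfl, -⟩ := hSmem l hl
        obtain ⟨v', rfl, -⟩ := hSmem l' hl'
        simpa using h
      have := ih (n - (a + b)) (by omega) (S.image (List.drop 2)) (by
        intro v hv
        obtain ⟨l, hl, rfl⟩ := Finset.mem_image.1 hv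
        obtain ⟨v, rfl, hlT⟩ := hSmem l hl
        obtain ⟨h3, h4⟩ := hT _ hlT
        rw [List.sum_cons, List.sum_cons] at h4
        exact ⟨fun c hc => h3 c (by simp at hc; simp [hc]), by simp; omega⟩)
      rw [Finset.sum_image hinj] at this
      have hsum : ∑ l ∈ S, (1 / 2 : ℝ) ^ switchCount d l =
          (1 / 2 : ℝ) ^ (if a = d + 1 ∧ b = d + 2 then 1 else 0) *
            ∑ l ∈ S, (1 / 2 : ℝ) ^ switchCount d (l.drop 2) := by
        rw [Finset.mul_sum]
        refine Finset.sum_congr rfl fun l hl => ?_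
        obtain ⟨v, rfl, -⟩ := hSmem l hl
        rw [switchCount, pow_add]
        rfl
      rw [hsum]
      set w : ℝ := (1 / 2 : ℝ) ^ (if a = d + 1 ∧ b = d + 2 then 1 else 0)
      have hw : 0 ≤ w := by positivity
      set V := ∑ l ∈ S, (1 / 2 : ℝ) ^ switchCount d (l.drop 2)
      calc w * V * r ^ n = w * r ^ (a + b) * (V * r ^ (n - (a + b))) := by
            rw [show r ^ n = r ^ (a + b) * r ^ (n - (a + b)) by
              rw [← pow_add, Nat.add_sub_of_le (by omega)]]
            ring
        _ ≤ w * r ^ (a + b) * K := by gcongr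
    rw [← Finset.sum_fiberwise_of_maps_to (fun l hl => Finset.mem_image_of_mem g hl), Finset.sum_mul]
    refine (Finset.sum_le_sum fun p hp => (hfib p hp).2).trans ?_
    rw [← Finset.sum_mul]
    gcongr
    exact hq _ fun p hp => (hfib p hp).1

theorem sum_pairs_le {d : ℕ} {k : ℕ∞} (hdk : (d : ℕ∞) < k) {r s : ℝ} (hr : 0 ≤ r)
    (h : HasSum (fun i : blockLengths d k => r ^ (i : ℕ)) s) (P : Finset (ℕ × ℕ))
    (hP : ∀ p ∈ P, p.1 ∈ blockLengths d k ∧ p.2 ∈ blockLengths d k) :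
    ∑ p ∈ P, (1 / 2 : ℝ) ^ (if p.1 = d + 1 ∧ p.2 = d + 2 then 1 else 0) * r ^ (p.1 + p.2)
      ≤ s ^ 2 - r ^ (2 * d + 3) / 2 := by
  classical
  set S : Finset ℕ := insert (d + 1) (insert (d + 2) (P.image Prod.fst ∪ P.image Prod.snd)) with hS
  have hSmem : ∀ a ∈ S, a ∈ blockLengths d k := by
    intro a ha
    simp only [hS, Finset.mem_insert, Finset.mem_union, Finset.mem_image] at ha
    rcases ha with rfl | rfl | ⟨p, hp, rfl⟩ | ⟨p, hp, rfl⟩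
    · exact add_one_mem_blockLengths hdk
    · exact add_two_mem_blockLengths hdk
    · exact (hP p hp).1
    · exact (hP p hp).2
  have hPS : P ⊆ S ×ˢ S := by
    intro p hp
    simp only [hS, Finset.mem_product, Finset.mem_insert, Finset.mem_union]
    exact ⟨Or.inr (Or.inr (Or.inl (Finset.mem_image_of_mem _ hp))),
      Or.inr (Or.inr (Or.inr (Finset.mem_image_of_mem _ hp)))⟩
  have hterm : ∀ p : ℕ × ℕ,
      (1 / 2 : ℝ) ^ (if p.1 = d + 1 ∧ p.2 = d + 2 then 1 else 0) * r ^ (p.1 + p.2) =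
        r ^ p.1 * r ^ p.2 - if p = (d + 1, d + 2) then r ^ (2 * d + 3) / 2 else 0 := by
    rintro ⟨a, b⟩
    simp only [Prod.mk.injEq]
    split_ifs with hab
    · obtain ⟨rfl, rfl⟩ := hab
      ring
    · ring
  calc _ ≤ ∑ p ∈ S ×ˢ S,
        (1 / 2 : ℝ) ^ (if p.1 = d + 1 ∧ p.2 = d + 2 then 1 else 0) * r ^ (p.1 + p.2) :=
        Finset.sum_le_sum_of_subset_of_nonneg hPS fun _ _ _ => by positivity
    _ = (∑ a ∈ S, r ^ a) ^ 2 - r ^ (2 * d + 3) / 2 := by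
        simp only [hterm, Finset.sum_sub_distrib]
        rw [sq, Finset.sum_mul_sum, Finset.sum_product, Finset.sum_ite_eq', if_pos]
        simp [hS]
    _ ≤ s ^ 2 - r ^ (2 * d + 3) / 2 := by
        gcongr
        exact sum_pow_le_of_hasSum hr h S hSmem

theorem exists_card_le_of_switchCount_lt {d : ℕ} {k : ℕ∞} (hdk : (d : ℕ∞) < k) {ρ : ℝ}
    (h : IsPositiveRoot d k ρ) : ∃ r K : ℝ, ρ < r ∧ 0 ≤ K ∧ ∀ n m : ℕ, ∀ T ⊆ blockLists d k n,
      (∀ l ∈ T, switchCount d l < m) → (T.card : ℝ) * r ^ n ≤ K * 2 ^ m := by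
  obtain ⟨r, hρr, hr1, hq⟩ := h.exists_gt hdk
  have hr0 : 0 ≤ r := h.1.le.trans hρr.le
  set q := lengthSeries d k r ^ 2 - r ^ (2 * d + 3) / 2
  have hq0 : 0 < 1 - q := by linarith
  refine ⟨r, (1 - q)⁻¹, hρr, by positivity, fun n m T hT hm => ?_⟩
  have hsum := sum_half_pow_switchCount_le (fun _ => pos_of_mem_blockLengths) d hr0 hr1.le
    (q := q) (K := (1 - q)⁻¹) (by positivity) (by
      have := mul_inv_cancel₀ hq0.ne'
      linarith)
    (sum_pairs_le hdk hr0 (summable_lengthSeries hr0 hr1).hasSum) n T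
    fun l hl => mem_blockLists.1 (hT hl)
  have hcard : (T.card : ℝ) * (1 / 2) ^ m ≤ ∑ l ∈ T, (1 / 2 : ℝ) ^ switchCount d l := by
    rw [← nsmul_eq_mul]
    exact Finset.card_nsmul_le_sum _ _ _ fun l hl =>
      pow_le_pow_of_le_one (by norm_num) (by norm_num) (hm l hl).le
  calc (T.card : ℝ) * r ^ n = (T.card : ℝ) * (1 / 2) ^ m * r ^ n * 2 ^ m := by
        rw [one_div, inv_pow]
        field_simp
    _ ≤ (∑ l ∈ T, (1 / 2 : ℝ) ^ switchCount d l) * r ^ n * 2 ^ m := by gcongr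
    _ ≤ (1 - q)⁻¹ * 2 ^ m := by gcongr

theorem CorrectsShifts.disjoint_switches {d n t : ℕ} {k : ℕ∞} (hdk : (d : ℕ∞) < k)
    {C : Finset (Fin n → Bool)} (hC : CorrectsShifts t C) {x y : Fin n → Bool} (hx : x ∈ C)
    (hy : y ∈ C) (hxy : x ≠ y) {l l' : List ℕ} (hl : l ∈ blockLists d k n)
    (hl' : l' ∈ blockLists d k n) (hxl : List.ofFn x = blockWord l)
    (hyl : List.ofFn y = blockWord l') : Disjoint (switches d t l) (switches d t l') := by
  refine Finset.disjoint_left.2 fun z hz hz' => ?_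
  obtain ⟨h1, -, -, h2⟩ := mem_switches_props (add_one_mem_blockLengths hdk)
    (add_two_mem_blockLengths hdk) hz (mem_blockLists.1 hl).1
  obtain ⟨h3, -, -, h4⟩ := mem_switches_props (add_one_mem_blockLengths hdk)
    (add_two_mem_blockLengths hdk) hz' (mem_blockLists.1 hl').1
  have hWx : weight x = z.length := by rw [weight_eq_length (pos_of_mem_blockLists hl) hxl, h1]
  have hWy : weight y = z.length := by rw [weight_eq_length (pos_of_mem_blockLists hl') hyl, h3]
  rw [partialSumDist, ← h1, ← Fin.sum_univ_eq_sum_range] at h2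
  rw [partialSumDist, ← h3, ← Fin.sum_univ_eq_sum_range] at h4
  refine hC x hx y hy hxy z.length hWx hWy _ _ h2 h4 (funext fun i => ?_)
  rw [Pi.add_apply, Pi.add_apply, positions_eq_sum_take (pos_of_mem_blockLists hl) hxl,
    positions_eq_sum_take (pos_of_mem_blockLists hl') hyl]
  ring

theorem exists_forall_maxCodeSize_le {d : ℕ} {k : ℕ∞} (hdk : (d : ℕ∞) < k) {ρ : ℝ}
    (h : IsPositiveRoot d k ρ) (t : ℕ) : ∃ r K : ℝ, ρ < r ∧ 0 ≤ K ∧ ∀ n m : ℕ,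
      (maxCodeSize d k n t : ℝ) * m.choose t ≤ (ρ ^ n)⁻¹ + K * 2 ^ m * m.choose t * (r ^ n)⁻¹ := by
  classical
  obtain ⟨r, K, hρr, hK, hbad⟩ := exists_card_le_of_switchCount_lt hdk h
  refine ⟨r, K, hρr, hK, fun n m => ?_⟩
  have hr : 0 < r := h.1.trans hρr
  obtain ⟨C, hCin, hC, hcard⟩ := exists_code_card_eq_maxCodeSize d k n t
  have hlists : ∀ x : Fin n → Bool, ∃ l, x ∈ C → l ∈ blockLists d k n ∧ List.ofFn x = blockWord l := by
    intro x
    by_cases hx : x ∈ C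
    · obtain ⟨l, hl, hxl⟩ := mem_kstar_blocks_iff.1 (hCin x hx)
      refine ⟨l, fun _ => ⟨mem_blockLists.2 ⟨hl, ?_⟩, hxl⟩⟩
      rw [← length_blockWord fun a ha => pos_of_mem_blockLengths (hl a ha), ← hxl,
        List.length_ofFn]
    · exact ⟨[], fun h => absurd h hx⟩
  choose f hf using hlists
  have hinj : Set.InjOn f (C : Set (Fin n → Bool)) := by
    intro x hx y hy hxy
    refine List.ofFn_injective ?_
    rw [(hf x hx).2, (hf y hy).2, hxy]
  set G := C.filter fun x => m ≤ switchCount d (f x) with hG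
  set B := C.filter fun x => ¬ m ≤ switchCount d (f x) with hB
  have hGB : (maxCodeSize d k n t : ℝ) = G.card + B.card := by
    rw [← hcard, ← Finset.card_filter_add_card_filter_not (s := C)
      (fun x => m ≤ switchCount d (f x))]
    push_cast
    rfl
  have hGC : ∀ x ∈ G, x ∈ C ∧ m ≤ switchCount d (f x) := fun x hx => Finset.mem_filter.1 hx
  have hBC : ∀ x ∈ B, x ∈ C ∧ ¬ m ≤ switchCount d (f x) := fun x hx => Finset.mem_filter.1 hx
  have hgood : G.card * m.choose t ≤ (blockLists d k n).card := by
    calc G.card * m.choose t ≤ ∑ x ∈ G, (switches d t (f x)).card := by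
          rw [← smul_eq_mul]
          refine Finset.card_nsmul_le_sum _ _ _ fun x hx => ?_
          rw [card_switches]
          exact Nat.choose_le_choose _ (hGC x hx).2
      _ = (G.biUnion fun x => switches d t (f x)).card := by
          rw [Finset.card_biUnion]
          intro x hx y hy hxy
          have hx := hGC x hx
          have hy := hGC y hy
          exact hC.disjoint_switches hdk hx.1 hy.1 hxy (hf x hx.1).1 (hf y hy.1).1
            (hf x hx.1).2 (hf y hy.1).2
      _ ≤ (blockLists d k n).card := by
          refine Finset.card_le_card fun z hz => ?_
          obtain ⟨x, hx, hz⟩ := Finset.mem_biUnion.1 hz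
          obtain ⟨h1, h2⟩ := mem_blockLists.1 (hf x (hGC x hx).1).1
          obtain ⟨-, i2, i3, -⟩ := mem_switches_props (add_one_mem_blockLengths hdk)
            (add_two_mem_blockLengths hdk) hz h1
          exact mem_blockLists.2 ⟨i3, i2.trans h2⟩
  have hbad' : (B.card : ℝ) * r ^ n ≤ K * 2 ^ m := by
    have := hbad n m (B.image f) (fun l hl => by
        obtain ⟨x, hx, rfl⟩ := Finset.mem_image.1 hl
        exact (hf x (hBC x hx).1).1) (fun l hl => by
        obtain ⟨x, hx, rfl⟩ := Finset.mem_image.1 hl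
        exact not_le.1 (hBC x hx).2)
    rwa [Finset.card_image_of_injOn (hinj.mono fun x hx => (hBC x hx).1)] at this
  have hgood' : (G.card : ℝ) * m.choose t ≤ (ρ ^ n)⁻¹ := by
    refine le_trans (by exact_mod_cast hgood) ((le_mul_inv_iff₀ (pow_pos h.1 n)).2
      (card_blockLists_mul_pow_le_one h n)) |>.trans_eq (one_mul _)
  have hbad'' : (B.card : ℝ) ≤ K * 2 ^ m * (r ^ n)⁻¹ := (le_mul_inv_iff₀ (pow_pos hr n)).2 hbad'
  rw [hGB, add_mul]
  refine add_le_add hgood' ?_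
  calc (B.card : ℝ) * m.choose t ≤ K * 2 ^ m * (r ^ n)⁻¹ * m.choose t := by gcongr
    _ = K * 2 ^ m * m.choose t * (r ^ n)⁻¹ := by ring

end BitShift

namespace BitShift

variable {d : ℕ} {k : ℕ∞} {ρ : ℝ}

theorem exists_le_maxCodeSize_mul (hdk : (d : ℕ∞) < k) (h : IsPositiveRoot d k ρ) (t : ℕ) :
    ∃ c > 0, ∀ᶠ n : ℕ in atTop, c ≤ (maxCodeSize d k n t : ℝ) * ρ ^ n * (n : ℝ) ^ t := by
  obtain ⟨c, hc, hN⟩ := exists_pos_le_card_blockLists hdk h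
  have hpos : (0 : ℝ) < 2 ^ t * (2 * t + 1) := by positivity
  refine ⟨c / (2 ^ t * (2 * t + 1)), by positivity, ?_⟩
  filter_upwards [eventually_ge_atTop ((d + 1) * (d + 1)), eventually_ne_atTop 0] with n hn hn0
  have h1 := card_blockLists_le_maxCodeSize d k t hn0
  have h2 : ((blockLists d k n).card : ℝ) ≤
      maxCodeSize d k n t * ((2 * n) ^ t * (2 * t + 1)) := by exact_mod_cast h1
  have hρ := pow_pos h.1 n
  rw [div_le_iff₀ hpos]
  calc c ≤ ((blockLists d k n).card : ℝ) * ρ ^ n := hN n hn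
    _ ≤ maxCodeSize d k n t * ((2 * n) ^ t * (2 * t + 1)) * ρ ^ n := by gcongr
    _ = maxCodeSize d k n t * ρ ^ n * (n : ℝ) ^ t * (2 ^ t * (2 * t + 1)) := by
      rw [mul_pow]
      ring

theorem pow_le_mul_choose_div {L t n : ℕ} (hL : 0 < L) (hn : 2 * t * L ≤ n) :
    n ^ t ≤ (2 * L) ^ t * t.factorial * (n / L).choose t := by
  have h1 : 2 * t ≤ n / L := (Nat.le_div_iff_mul_le hL).2 hn
  have h2 : n < L * (n / L + 1) := by
    rw [mul_comm]
    exact Nat.lt_mul_of_div_lt (Nat.lt_succ_self _) hL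
  have h3 : n ≤ 2 * L * (n / L + 1 - t) :=
    calc n ≤ L * (n / L + 1) := h2.le
      _ ≤ L * (2 * (n / L + 1 - t)) := Nat.mul_le_mul_left _ (by omega)
      _ = 2 * L * (n / L + 1 - t) := by ring
  calc n ^ t ≤ (2 * L * (n / L + 1 - t)) ^ t := Nat.pow_le_pow_left h3 t
    _ = (2 * L) ^ t * (n / L + 1 - t) ^ t := mul_pow _ _ _
    _ ≤ (2 * L) ^ t * (t.factorial * (n / L).choose t) := by
      gcongr
      rw [← Nat.descFactorial_eq_factorial_mul_choose]
      exact Nat.pow_sub_le_descFactorial _ _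
    _ = _ := by ring

theorem exists_maxCodeSize_mul_le (hdk : (d : ℕ∞) < k) (h : IsPositiveRoot d k ρ) (t : ℕ) :
    ∃ c : ℝ, ∀ᶠ n : ℕ in atTop, (maxCodeSize d k n t : ℝ) * ρ ^ n * (n : ℝ) ^ t ≤ c := by
  obtain ⟨r, K, hρr, hK, hM⟩ := exists_forall_maxCodeSize_le hdk h t
  have hρ := h.1
  have hq : 1 < r / ρ := (one_lt_div hρ).2 hρr
  obtain ⟨L, hL⟩ := pow_unbounded_of_one_lt 4 hq
  have hL0 : 0 < L := by
    rcases Nat.eq_zero_or_pos L with rfl | hL0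
    · norm_num at hL
    · exact hL0
  refine ⟨(2 * L) ^ t * t.factorial * (1 + K), ?_⟩
  filter_upwards [eventually_ge_atTop (2 * t * L)] with n hn
  set m := n / L with hm
  have hchoose : (n : ℝ) ^ t ≤ (2 * L) ^ t * t.factorial * m.choose t := by
    exact_mod_cast pow_le_mul_choose_div hL0 hn
  have h2m : (m.choose t : ℝ) ≤ 2 ^ m := by exact_mod_cast Nat.choose_le_two_pow m t
  have h4m : (4 : ℝ) ^ m ≤ (r / ρ) ^ n :=
    calc (4 : ℝ) ^ m ≤ ((r / ρ) ^ L) ^ m := by gcongr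
      _ = (r / ρ) ^ (L * m) := (pow_mul _ _ _).symm
      _ ≤ (r / ρ) ^ n := pow_le_pow_right₀ hq.le (Nat.mul_div_le n L)
  have hρn := pow_pos hρ n
  have hrn := pow_pos (hρ.trans hρr) n
  have hsmall : (2 : ℝ) ^ m * m.choose t * (r ^ n)⁻¹ * ρ ^ n ≤ 1 := by
    rw [div_pow, le_div_iff₀ hρn] at h4m
    calc (2 : ℝ) ^ m * m.choose t * (r ^ n)⁻¹ * ρ ^ n
        ≤ 2 ^ m * 2 ^ m * (r ^ n)⁻¹ * ρ ^ n := by gcongr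
      _ = 4 ^ m * ρ ^ n * (r ^ n)⁻¹ := by
        rw [← mul_pow]
        norm_num
        ring
      _ ≤ r ^ n * (r ^ n)⁻¹ := by gcongr
      _ = 1 := mul_inv_cancel₀ hrn.ne'
  have hmain : (maxCodeSize d k n t : ℝ) * m.choose t * ρ ^ n ≤ 1 + K :=
    calc (maxCodeSize d k n t : ℝ) * m.choose t * ρ ^ n
        ≤ ((ρ ^ n)⁻¹ + K * 2 ^ m * m.choose t * (r ^ n)⁻¹) * ρ ^ n := by
          gcongr
          exact hM n m
      _ = 1 + K * (2 ^ m * m.choose t * (r ^ n)⁻¹ * ρ ^ n) := by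
          rw [add_mul, inv_mul_cancel₀ hρn.ne']
          ring
      _ ≤ 1 + K * 1 := by gcongr
      _ = 1 + K := by rw [mul_one]
  calc (maxCodeSize d k n t : ℝ) * ρ ^ n * (n : ℝ) ^ t
      ≤ maxCodeSize d k n t * ρ ^ n * ((2 * L) ^ t * t.factorial * m.choose t) := by gcongr
    _ = (2 * L) ^ t * t.factorial * (maxCodeSize d k n t * m.choose t * ρ ^ n) := by ring
    _ ≤ (2 * L) ^ t * t.factorial * (1 + K) := by gcongr

end BitShift

theorem corollary2 (t : ℕ) (ht : 1 ≤ t) (d : ℕ) (k : ℕ∞) (hdk : (d : ℕ∞) < k) :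
    (∃! ρ : ℝ, BitShift.IsPositiveRoot d k ρ) ∧
    ∀ ρ : ℝ, BitShift.IsPositiveRoot d k ρ →
      (fun n : ℕ => Real.logb 2 (BitShift.maxCodeSize d k n t : ℝ)
          - (-(n : ℝ) * Real.logb 2 ρ - (t : ℝ) * Real.logb 2 (n : ℝ)))
        =O[atTop] (fun _ : ℕ => (1 : ℝ)) := by
  refine ⟨BitShift.existsUnique_isPositiveRoot hdk, fun ρ h => ?_⟩
  obtain ⟨c₁, hc₁, h₁⟩ := BitShift.exists_le_maxCodeSize_mul hdk h t
  obtain ⟨c₂, h₂⟩ := BitShift.exists_maxCodeSize_mul_le hdk h t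
  refine IsBigO.of_bound (max |Real.logb 2 c₁| |Real.logb 2 c₂|) ?_
  filter_upwards [h₁, h₂, eventually_ne_atTop 0] with n h₁ h₂ hn
  have hn' : (n : ℝ) ≠ 0 := by exact_mod_cast hn
  have hM : (BitShift.maxCodeSize d k n t : ℝ) ≠ 0 := by
    intro h0
    rw [h0, zero_mul, zero_mul] at h₁
    linarith
  have hlog : Real.logb 2 (BitShift.maxCodeSize d k n t : ℝ)
      - (-(n : ℝ) * Real.logb 2 ρ - (t : ℝ) * Real.logb 2 (n : ℝ))
      = Real.logb 2 ((BitShift.maxCodeSize d k n t : ℝ) * ρ ^ n * (n : ℝ) ^ t) := by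
    rw [Real.logb_mul (mul_ne_zero hM (pow_pos h.1 n).ne') (pow_ne_zero _ hn'),
      Real.logb_mul hM (pow_pos h.1 n).ne', Real.logb_pow, Real.logb_pow]
    ring
  rw [hlog, norm_one, mul_one, Real.norm_eq_abs]
  exact abs_le_max_abs_abs (Real.logb_le_logb_of_le one_lt_two hc₁ h₁)
    (Real.logb_le_logb_of_le one_lt_two (hc₁.trans_le h₁) h₂)
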